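/- Let $k$ be an algebraically closed field, let $S = k[[\alpha_1,\dots,\alpha_n]]$ with maximal ideal $\mathfrak m$, and let $P = k_{dp}[x_1,\dots,x_n]$ be the divided power polynomials, i.e. the $k$-vector space with basis $x^{[a]}$, $a\in\mathbb N^n$, where $x^{[a]}$ has degree $|a| = \sum a_i$. Let $\langle\cdot,\cdot\rangle\colon S\times P\to k$ be the pairing given by $\langle \sum_b c_b\alpha^b, x^{[a]}\rangle = c_a$, and let $S$ act on $P$ by contraction $\lrcorner$, defined by $\langle \tau,\sigma\lrcorner f\rangle = \langle\tau\sigma,f\rangle$ for all $\tau\in S$ (so $\alpha^a\lrcorner x^{[b]} = x^{[b-a]}$ if $a\le b$ and $0$ otherwise). For $f\in P$ put $\operatorname{Ann}(f) = \{\sigma\in S : \sigma\lrcorner f=0\}$ and $\operatorname{Apolar}(f) = S/\operatorname{Ann}(f)$. Let $P_{\le e}$ be the space of elements of $P$ of degree at most $e$, and let $f_{\ge e}$ be the sum of the homogeneous parts of $f$ of degree at least $e$. For a local Artinian quotient $A = S/I$ with maximal ideal $\mathfrak m_A$ let $H_A(i) = \dim_k \mathfrak m_A^i/\mathfrak m_A^{i+1}$,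 and let its socle degree be the largest $d$ with $\mathfrak m_A^d\ne 0$. For an integer $t\ge 1$, the algebra $A$ (of socle degree $d$) is called $t$-compressed if $H_A(i) = \binom{i+n-1}{i}$ for all $0\le i\le t$ and $H_A(d-1) = n$. Let $G^+$ be the group of $k$-linear automorphisms of $S$ of the form $\sigma\mapsto s\,\varphi(\sigma)$, where $s\in 1+\mathfrak m$ and $\varphi$ is a $k$-algebra automorphism of $S$ with $\varphi(\alpha_i)-\alpha_i\in\mathfrak m^2$ for all $i$. An element $L\in G^+$ acts on $P$ by its transpose $L^\vee$, where $\langle\sigma, L^\vee f\rangle = \langle L\sigma, f\rangle$ for all $\sigma\in S$; let $G^+\cdot f = \{L^\vee f : L\in G^+\}$. **Proposition.** Let $f\in P$ have degree $d\ge 3$, where $\operatorname{char} k = 0$ or $\operatorname{char} k > d$, and suppose that $\operatorname{Apolar}(f)$ is $t$-compressed. If $n=1$, assume moreover that $t\le d-2$. Then $$f + P_{\le t+1}\subseteq G^+\cdot f.$$ In particular $f_{\ge t+2}\in G^+\cdot f$, and $\operatorname{Apolar}(f)\simeq\operatorname{Apolar}(f_{\ge t+2})$ as $k$-algebras. -/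

import Mathlib

noncomputable section

namespace Apolarity

/-- The power series ring `S = k[[α₁, …, αₙ]]`. -/
abbrev S (k : Type*) [Field k] (n : ℕ) : Type _ := MvPowerSeries (Fin n) k

/-- The maximal ideal `𝔪` of `S`. -/
abbrev mS (k : Type*) [Field k] (n : ℕ) : Ideal (S k n) := IsLocalRing.maximalIdeal (S k n)

/-- The divided power polynomials `P = k_dp[x₁, …, xₙ]`, written in the basis of the divided
power monomials `x^[a]`, `a ∈ ℕⁿ`: the value `f a` is the coefficient of `f` at `x^[a]`. -/
abbrev P (k : Type*) [Field k] (n : ℕ) : Type _ := (Fin n →₀ ℕ) →₀ k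

variable {k : Type*} [Field k] {n : ℕ}

/-- The pairing `⟨σ, f⟩` between `S` and `P`, for which the `x^[a]` are dual to the monomials
`α^a`. It identifies `P` with the space of functionals on `S` that vanish on some power
of `𝔪`. -/
def pairing (σ : S k n) (f : P k n) : k :=
  f.sum fun a c => MvPowerSeries.coeff a σ * c

/-- The contraction action of `S` on `P`: `α^a ⌟ x^[b]` is `x^[b - a]` if `a ≤ b`
and `0` otherwise. -/
def contract (σ : S k n) (f : P k n) : P k n :=
  f.sum fun b c => ∑ p ∈ Finset.HasAntidiagonal.antidiagonal b,
    Finsupp.single p.2 (MvPowerSeries.coeff p.1 σ * c)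

theorem contract_zero_left (f : P k n) : contract (0 : S k n) f = 0 := by
  simp [contract]

theorem contract_add_left (σ τ : S k n) (f : P k n) :
    contract (σ + τ) f = contract σ f + contract τ f := by
  simp [contract, add_mul, Finset.sum_add_distrib, Finsupp.sum_add]

theorem pairing_add_right (σ : S k n) (f g : P k n) :
    pairing σ (f + g) = pairing σ f + pairing σ g := by
  unfold pairing
  rw [Finsupp.sum_add_index'] <;> simp [mul_add]

theorem pairing_single (σ : S k n) (a : Fin n →₀ ℕ) (c : k) :
    pairing σ (Finsupp.single a c) = MvPowerSeries.coeff a σ * c := by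
  simp [pairing]

theorem pairing_monomial (a : Fin n →₀ ℕ) (f : P k n) :
    pairing (MvPowerSeries.monomial a (1 : k)) f = f a := by
  classical
  simp only [pairing, MvPowerSeries.coeff_monomial, ite_mul, one_mul, zero_mul]
  rw [Finsupp.sum, Finset.sum_ite_eq' f.support a]
  split_ifs with h
  · rfl
  · exact (Finsupp.notMem_support_iff.mp h).symm

theorem eq_of_pairing_eq {f g : P k n} (h : ∀ σ : S k n, pairing σ f = pairing σ g) :
    f = g := by
  ext a
  rw [← pairing_monomial, ← pairing_monomial, h]

/-- Contraction is the transpose of multiplication. -/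
theorem pairing_contract (τ σ : S k n) (f : P k n) :
    pairing τ (contract σ f) = pairing (τ * σ) f := by
  classical
  have key : ∀ (s : Finset (Fin n →₀ ℕ)) (F : (Fin n →₀ ℕ) → P k n),
      pairing τ (∑ a ∈ s, F a) = ∑ a ∈ s, pairing τ (F a) := fun s F =>
    map_sum (⟨⟨pairing τ, by simp [pairing]⟩, pairing_add_right τ⟩ : P k n →+ k) F s
  have key' : ∀ (s : Finset ((Fin n →₀ ℕ) × (Fin n →₀ ℕ)))
      (F : ((Fin n →₀ ℕ) × (Fin n →₀ ℕ)) → P k n),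
      pairing τ (∑ a ∈ s, F a) = ∑ a ∈ s, pairing τ (F a) := fun s F =>
    map_sum (⟨⟨pairing τ, by simp [pairing]⟩, pairing_add_right τ⟩ : P k n →+ k) F s
  rw [contract, Finsupp.sum, key, pairing, Finsupp.sum]
  refine Finset.sum_congr rfl fun b _ => ?_
  rw [key', mul_comm τ σ, MvPowerSeries.coeff_mul, Finset.sum_mul]
  refine Finset.sum_congr rfl fun p _ => ?_
  rw [pairing_single]
  ring

theorem contract_mul (τ σ : S k n) (f : P k n) :
    contract (τ * σ) f = contract τ (contract σ f) := by
  refine eq_of_pairing_eq fun ρ => ?_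
  rw [pairing_contract, pairing_contract, pairing_contract, mul_assoc]

/-- The apolar ideal `Ann(f) = {σ | σ ⌟ f = 0}`. -/
def Ann (f : P k n) : Ideal (S k n) where
  carrier := {σ | contract σ f = 0}
  zero_mem' := contract_zero_left f
  add_mem' := by
    intro σ τ hσ hτ
    rw [Set.mem_ofPred_eq] at *
    rw [contract_add_left, hσ, hτ, add_zero]
  smul_mem' := by
    intro τ σ hσ
    rw [Set.mem_ofPred_eq] at *
    rw [smul_eq_mul, contract_mul, hσ]
    simp [contract]

/-- The apolar algebra `S / Ann(f)`. -/
abbrev Apolar (f : P k n) : Type _ := S k n ⧸ Ann f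

/-- The degree of `f`: the largest `|a|` such that `x^[a]` occurs in `f`. -/
def deg (f : P k n) : ℕ := f.support.sup Finsupp.degree

variable (k n) in
/-- `P_{≤ e}`: the divided power polynomials of degree at most `e`. -/
def PLE (e : ℕ) : Submodule k (P k n) := Finsupp.supported k k {a | a.degree ≤ e}

/-- `f_{≥ e}`: the sum of the homogeneous parts of `f` of degree at least `e`. -/
def partGE (e : ℕ) (f : P k n) : P k n := f.filter fun a => e ≤ a.degree

/-- For an ideal `I` of `S`, the image of `𝔪` in `S / I`. If `I` is proper this is the
maximal ideal of the local ring `S / I`. -/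
def mQuot (I : Ideal (S k n)) : Ideal (S k n ⧸ I) := (mS k n).map (Ideal.Quotient.mk I)

/-- The Hilbert function `H_A(i) = dim_k 𝔪_A^i / 𝔪_A^(i+1)` of `A = S / I`. -/
def hilbertFunction (I : Ideal (S k n)) (i : ℕ) : ℕ :=
  Module.finrank k (↥(mQuot I ^ i) ⧸ (mQuot I ^ (i + 1)).submoduleOf (mQuot I ^ i))

/-- `d` is the socle degree of `A = S / I`: the largest `i` with `𝔪_A^i ≠ 0`. -/
def IsSocleDegree (I : Ideal (S k n)) (d : ℕ) : Prop := IsGreatest {i | mQuot I ^ i ≠ ⊥} d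

/-- `A = S / I`, of socle degree `d`, is `t`-compressed: `t ≥ 1`, `H_A(i) = H_S(i)` for
`0 ≤ i ≤ t`, and `H_A(d - 1) = H_S(1)`. -/
def IsCompressed (I : Ideal (S k n)) (t : ℕ) : Prop :=
  1 ≤ t ∧ (∀ i ≤ t, hilbertFunction I i = (i + n - 1).choose i) ∧
    ∃ d, IsSocleDegree I d ∧ hilbertFunction I (d - 1) = n

theorem map_mem_pow (φ : S k n ≃ₐ[k] S k n) (j : ℕ) {σ : S k n} (h : σ ∈ mS k n ^ j) :
    φ σ ∈ mS k n ^ j := by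
  have h1 : (mS k n).map (φ : S k n →+* S k n) ≤ mS k n := by
    rw [Ideal.map_le_iff_le_comap]
    intro x hx
    rw [Ideal.mem_comap, IsLocalRing.mem_maximalIdeal, mem_nonunits_iff]
    rw [IsLocalRing.mem_maximalIdeal, mem_nonunits_iff] at hx
    exact fun hu => hx ((MulEquiv.isUnit_map φ).mp hu)
  have h2 := Ideal.mem_map_of_mem (φ : S k n →+* S k n) h
  rw [Ideal.map_pow] at h2
  exact Ideal.pow_right_mono h1 j h2

theorem map_mem (φ : S k n ≃ₐ[k] S k n) {σ : S k n} (h : σ ∈ mS k n) : φ σ ∈ mS k n := by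
  simpa using map_mem_pow φ 1 (σ := σ) (by simpa using h)

variable (k n) in
/-- `Aut⁺(S)`: the automorphisms `φ` of the `k`-algebra `S` with `φ(αᵢ) - αᵢ ∈ 𝔪²`
for all `i`. -/
def AutPlus : Subgroup (S k n ≃ₐ[k] S k n) where
  carrier := {φ | ∀ i, φ (MvPowerSeries.X i) - MvPowerSeries.X i ∈ mS k n ^ 2}
  one_mem' := by intro i; simp
  mul_mem' := by
    intro φ ψ hφ hψ i
    have := (mS k n ^ 2).add_mem (map_mem_pow φ 2 (hψ i)) (hφ i)
    simpa using this
  inv_mem' := by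
    intro φ hφ i
    have := (mS k n ^ 2).neg_mem (map_mem_pow φ⁻¹ 2 (hφ i))
    have h1 : φ⁻¹ (φ (MvPowerSeries.X i)) = MvPowerSeries.X i := φ.symm_apply_apply _
    rwa [map_sub, h1, neg_sub] at this

theorem isUnit_of_sub_one_mem {s : S k n} (hs : s - 1 ∈ mS k n) : IsUnit s := by
  by_contra h
  have h1 : s ∈ mS k n := by rwa [IsLocalRing.mem_maximalIdeal, mem_nonunits_iff]
  have h2 : (1 : S k n) ∈ mS k n := by
    have := (mS k n).sub_mem h1 hs
    simpa using this
  exact (Ideal.ne_top_iff_one _).mp (IsLocalRing.maximalIdeal.isMaximal _).ne_top h2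

variable (k n) in
/-- The group `G⁺ = Aut⁺(S) ⋉ (1 + 𝔪)` inside the group of `k`-linear automorphisms of `S`:
the operators `σ ↦ s · φ(σ)` with `φ ∈ Aut⁺(S)` and `s ∈ 1 + 𝔪`. -/
def GPlus : Subgroup (S k n ≃ₗ[k] S k n) where
  carrier := {L | ∃ φ ∈ AutPlus k n, ∃ s : S k n, s - 1 ∈ mS k n ∧ ∀ σ, L σ = s * φ σ}
  one_mem' := ⟨1, one_mem _, 1, by simp, fun σ => by simp⟩
  mul_mem' := by
    rintro L M ⟨φ, hφ, s, hs, hL⟩ ⟨ψ, hψ, u, hu, hM⟩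
    refine ⟨φ * ψ, mul_mem hφ hψ, s * φ u, ?_, fun σ => ?_⟩
    · have h1 : φ u - 1 ∈ mS k n := by simpa using map_mem φ hu
      have h2 := (mS k n).add_mem ((mS k n).mul_mem_left s h1) hs
      have h3 : s * φ u - 1 = s * (φ u - 1) + (s - 1) := by ring
      rwa [h3]
    · rw [LinearEquiv.mul_apply, hM, hL, map_mul, AlgEquiv.mul_apply, mul_assoc]
  inv_mem' := by
    rintro L ⟨φ, hφ, s, hs, hL⟩
    obtain ⟨u, rfl⟩ := isUnit_of_sub_one_mem hs
    refine ⟨φ⁻¹, inv_mem hφ, φ⁻¹ (↑u⁻¹ : S k n), ?_, fun σ => ?_⟩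
    · have h1 : (↑u⁻¹ : S k n) - 1 ∈ mS k n := by
        have h2 := (mS k n).neg_mem ((mS k n).mul_mem_left (↑u⁻¹ : S k n) hs)
        have h3 : -((↑u⁻¹ : S k n) * (↑u - 1)) = (↑u⁻¹ : S k n) - 1 := by
          rw [mul_sub, Units.inv_mul]; ring
        rwa [h3] at h2
      simpa using map_mem φ⁻¹ h1
    · have hc : ∀ x, φ (φ⁻¹ x) = x := φ.apply_symm_apply
      have hLc : L (L⁻¹ σ) = σ := L.apply_symm_apply σ
      apply L.injective
      rw [hLc, hL, map_mul, hc, hc, ← mul_assoc, Units.mul_inv, one_mul]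

/-- The orbit of `f` under the action of `G⁺` on `P`, in which `L ∈ G⁺` acts by its transpose
`L^∨`, determined by `⟨σ, L^∨ f⟩ = ⟨L σ, f⟩` for all `σ ∈ S`. -/
def orbitPlus (f : P k n) : Set (P k n) :=
  {g | ∃ L ∈ GPlus k n, ∀ σ : S k n, pairing σ g = pairing (L σ) f}

end Apolarity

end

/-!
The group `G⁺` has as Lie algebra the operators `σ ↦ sσ + Dσ` with `s ∈ 𝔪` and `D` a derivation
with `D αᵢ ∈ 𝔪²`, so its orbit through `f` has as tangent space at `f` the space of all transposes
of these operators applied to `f`. By duality, a power series `σ` annihilating this space lies in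
`𝔪` and has all its partial derivatives in the colon ideal `(Ann f : 𝔪²)`. For `t`-compressed
`Apolar f` this ideal is contained in `𝔪 ^ (t + 1)`: the condition `H (d - 1) = n` places it inside
`𝔪 ^ (d - 1) + Ann f`, and the maximality of `H i` for `i ≤ t` places `Ann f` inside `𝔪 ^ (t + 1)`.
As the characteristic is zero or large, `σ ∈ 𝔪 ^ (t + 2)` follows, so the tangent space contains
all polynomials of degree at most `t + 1`.

If `h` is a tangent vector, the exponential of the corresponding operator, truncated after degree
`d`, is congruent modulo `𝔪 ^ (d + 1)` to an element of `G⁺`. This element moves `f` to `f + h` up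
to terms of degree smaller than that of `h`. Since the tangency bound holds at every point of the
orbit, induction on the degree of `h` gives the inclusion.
-/

namespace Apolarity

open MvPowerSeries

section AdicOrder

variable {R A : Type*} [CommRing R] [CommRing A] [Algebra R A] {J : Ideal A}

/-- An `R`-linear operator on `A` raises the `J`-adic order if it maps `J ^ j` into `J ^ (j + 1)`
for all `j`. -/
def RaisesAdicOrder (J : Ideal A) (N : Module.End R A) : Prop :=
  ∀ ⦃j : ℕ⦄ ⦃a : A⦄, a ∈ J ^ j → N a ∈ J ^ (j + 1)

namespace RaisesAdicOrder

variable {M N : Module.End R A}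

theorem add (hM : RaisesAdicOrder J M) (hN : RaisesAdicOrder J N) : RaisesAdicOrder J (M + N) :=
  fun _ _ ha => add_mem (hM ha) (hN ha)

theorem mulLeft {s : A} (hs : s ∈ J) : RaisesAdicOrder J (LinearMap.mulLeft R s) := by
  intro j a ha
  rw [LinearMap.mulLeft_apply, pow_succ']
  exact Ideal.mul_mem_mul hs ha

theorem pow_apply_mem (hN : RaisesAdicOrder J N) (i : ℕ) {j : ℕ} {a : A} (ha : a ∈ J ^ j) :
    (N ^ i) a ∈ J ^ (j + i) := by
  induction i with
  | zero => simpa using ha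
  | succ i ih => rw [pow_succ', Module.End.mul_apply]; exact hN ih

theorem injective_one_sub [IsHausdorff J A] (hN : RaisesAdicOrder J N) :
    Function.Injective ⇑(1 - N) := by
  refine (injective_iff_map_eq_zero _).mpr fun a ha => ?_
  have hfix : a = N a := sub_eq_zero.mp ha
  have hmem : ∀ j, a ∈ J ^ j := by
    intro j
    induction j with
    | zero => simp
    | succ j ih => rw [hfix]; exact hN ih
  exact IsHausdorff.haus' (I := J) a fun j => SModEq.zero.mpr (by simpa using hmem j)

theorem surjective_one_sub [IsAdicComplete J A] (hN : RaisesAdicOrder J N) :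
    Function.Surjective ⇑(1 - N) := by
  intro a
  let partialSum : ℕ → A := fun e => (∑ i ∈ Finset.range e, N ^ i) a
  have hcauchy : ∀ {m e}, m ≤ e → partialSum m ≡ partialSum e [SMOD (J ^ m • ⊤ : Ideal A)] := by
    intro m e h
    rw [SModEq.comm, SModEq.sub_mem, ← LinearMap.sub_apply, ← Finset.sum_Ico_eq_sub _ h,
      LinearMap.sum_apply, smul_eq_mul, Ideal.mul_top]
    refine Ideal.sum_mem _ fun i hi => Ideal.pow_le_pow_right (Finset.mem_Ico.mp hi).1 ?_
    simpa using hN.pow_apply_mem i (j := 0) (a := a) (by simp)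
  obtain ⟨b, hb⟩ := IsPrecomplete.prec' partialSum hcauchy
  refine ⟨b, sub_eq_zero.mp (IsHausdorff.haus' (I := J) _ fun e => SModEq.zero.mpr ?_)⟩
  rw [smul_eq_mul, Ideal.mul_top]
  have htelescope : (1 - N) (partialSum e) = a - (N ^ e) a :=
    LinearMap.congr_fun (mul_neg_geom_sum N e) a
  have hlimit : partialSum e - b ∈ J ^ e := by simpa [SModEq.sub_mem] using hb e
  have hpow : (N ^ e) a ∈ J ^ e := by simpa using hN.pow_apply_mem e (j := 0) (a := a) (by simp)
  have hdecomp : (1 - N) b - a = N (partialSum e - b) - (partialSum e - b) - (N ^ e) a := by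
    simp only [LinearMap.sub_apply, Module.End.one_apply, map_sub] at htelescope ⊢
    linear_combination htelescope
  rw [hdecomp]
  exact sub_mem (sub_mem (Ideal.pow_le_pow_right e.le_succ (hN hlimit)) hlimit) hpow

theorem bijective_one_sub [IsAdicComplete J A] (hN : RaisesAdicOrder J N) :
    Function.Bijective ⇑(1 - N) :=
  ⟨hN.injective_one_sub, hN.surjective_one_sub⟩

theorem of_twisted_leibniz {s : Set A} {φ : A → A}
    (hconst : ∀ a, ∃ c : R, a - algebraMap R A c ∈ Ideal.span s)
    (hφ : ∀ a ∈ Ideal.span s, φ a ∈ Ideal.span s)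
    (hmul : ∀ a b, N (a * b) = N a * φ b + a * N b) (hone : N 1 = 0)
    (hs : ∀ x ∈ s, N x ∈ Ideal.span s ^ 2) : RaisesAdicOrder (Ideal.span s) N := by
  set J := Ideal.span s
  have hN : ∀ a ∈ J, N a ∈ J := fun a ha => by
    induction ha using Submodule.span_induction with
    | mem x hx => exact Ideal.pow_le_self two_ne_zero (hs x hx)
    | zero => simp
    | add x y _ _ hx hy => rw [map_add]; exact add_mem hx hy
    | smul a x hxs hx =>
      rw [smul_eq_mul, hmul]
      exact add_mem (Ideal.mul_mem_left _ _ (hφ x hxs)) (Ideal.mul_mem_left _ _ hx)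
  have hrange : ∀ a, N a ∈ J := fun a => by
    obtain ⟨c, hc⟩ := hconst a
    have := hN _ hc
    rwa [map_sub, Algebra.algebraMap_eq_smul_one, map_smul, hone, smul_zero, sub_zero] at this
  have hsq : ∀ a ∈ J, N a ∈ J ^ 2 := fun a ha => by
    induction ha using Submodule.span_induction with
    | mem x hx => exact hs x hx
    | zero => simp
    | add x y _ _ hx hy => rw [map_add]; exact add_mem hx hy
    | smul a x hxs hx =>
      rw [smul_eq_mul, hmul]
      refine add_mem ?_ (Ideal.mul_mem_left _ _ hx)
      rw [pow_two]
      exact Ideal.mul_mem_mul (hrange a) (hφ x hxs)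
  intro j
  induction j with
  | zero => intro a _; simpa using hrange a
  | succ j ih =>
    intro a ha
    rw [pow_succ] at ha
    induction ha using Submodule.mul_induction_on' with
    | mem_mul_mem x hx y hy =>
      rw [hmul]
      refine add_mem ?_ ?_
      · rw [pow_succ]; exact Ideal.mul_mem_mul (ih hx) (hφ y hy)
      · rw [add_assoc, pow_add]; exact Ideal.mul_mem_mul hx (hsq y hy)
    | add x _ y _ hx hy => rw [map_add]; exact add_mem hx hy

end RaisesAdicOrder

theorem pow_apply_mul_of_leibniz {L D : Module.End R A}
    (hL : ∀ a b, L (a * b) = L a * b + a * D b) (m : ℕ) (a b : A) : (L ^ m) (a * b) =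
      ∑ p ∈ Finset.HasAntidiagonal.antidiagonal m, m.choose p.1 • ((L ^ p.1) a * (D ^ p.2) b) := by
  induction m with
  | zero => simp
  | succ m ih =>
    rw [pow_succ', Module.End.mul_apply, ih, map_sum,
      Finset.sum_antidiagonal_choose_succ_nsmul fun i j => (L ^ i) a * (D ^ j) b,
      ← Finset.sum_add_distrib]
    refine Finset.sum_congr rfl fun p hp => ?_
    rw [map_nsmul, hL, pow_succ', pow_succ', Module.End.mul_apply, Module.End.mul_apply, smul_add,
      add_comm, Nat.choose_symm_of_eq_add (Finset.HasAntidiagonal.mem_antidiagonal.mp hp).symm]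

end AdicOrder

section TruncExp

theorem cast_factorial_ne_zero_of_le {k : Type*} [NonAssocSemiring k] {m d : ℕ} (hmd : m ≤ d)
    (hd : (d.factorial : k) ≠ 0) : (m.factorial : k) ≠ 0 := by
  obtain ⟨c, hc⟩ := Nat.factorial_dvd_factorial hmd
  rw [hc, Nat.cast_mul] at hd
  exact left_ne_zero_of_mul hd

variable {k A : Type*} [Field k]

/-- The exponential series of `M`, truncated after the term of degree `d`. -/
noncomputable def truncExp [AddCommGroup A] [Module k A] (d : ℕ) (M : Module.End k A) :
    Module.End k A :=
  ∑ i ∈ Finset.range (d + 1), (i.factorial : k)⁻¹ • M ^ i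

theorem truncExp_apply [AddCommGroup A] [Module k A] (d : ℕ) (M : Module.End k A) (a : A) :
    truncExp d M a = ∑ i ∈ Finset.range (d + 1), (i.factorial : k)⁻¹ • (M ^ i) a := by
  simp [truncExp, LinearMap.sum_apply]

theorem truncExp_apply_of_apply_eq_zero [AddCommGroup A] [Module k A] (d : ℕ)
    {M : Module.End k A} {a : A} (ha : M a = 0) : truncExp d M a = a := by
  rw [truncExp_apply, Finset.sum_range_succ', Finset.sum_eq_zero, zero_add]
  · simp
  · intro i _
    rw [pow_succ, Module.End.mul_apply, ha, map_zero, smul_zero]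

variable [CommRing A] [Algebra k A] {J : Ideal A} {L D M : Module.End k A}

theorem RaisesAdicOrder.truncExp_apply_mem (hM : RaisesAdicOrder J M) (d : ℕ) {j : ℕ} {a : A}
    (ha : a ∈ J ^ j) : truncExp d M a ∈ J ^ j := by
  rw [truncExp_apply]
  exact Ideal.sum_mem _ fun i _ => Submodule.smul_of_tower_mem _ _
    (Ideal.pow_le_pow_right (Nat.le_add_right j i) (hM.pow_apply_mem i ha))

theorem RaisesAdicOrder.truncExp_apply_sub_self_mem (hM : RaisesAdicOrder J M) (d : ℕ) {j : ℕ}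
    {a : A} (ha : a ∈ J ^ j) : truncExp d M a - a ∈ J ^ (j + 1) := by
  rw [truncExp_apply, Finset.sum_range_succ']
  simp only [Nat.factorial_zero, Nat.cast_one, inv_one, pow_zero, one_smul, Module.End.one_apply,
    add_sub_cancel_right]
  exact Ideal.sum_mem _ fun i _ => Submodule.smul_of_tower_mem _ _
    (Ideal.pow_le_pow_right (by omega) (hM.pow_apply_mem (i + 1) ha))

theorem RaisesAdicOrder.exists_truncExp_apply_eq (hM : RaisesAdicOrder J M) {d : ℕ} (hd : d ≠ 0)
    {j : ℕ} {a : A} (ha : a ∈ J ^ j) : ∃ b ∈ J ^ (j + 1), truncExp d M a = a + M (a + b) := by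
  obtain ⟨d, rfl⟩ := Nat.exists_eq_succ_of_ne_zero hd
  refine ⟨∑ i ∈ Finset.range d, ((i + 1 + 1).factorial : k)⁻¹ • (M ^ (i + 1)) a,
    Ideal.sum_mem _ fun i _ => Submodule.smul_of_tower_mem _ _
      (Ideal.pow_le_pow_right (by omega) (hM.pow_apply_mem (i + 1) ha)), ?_⟩
  rw [truncExp_apply, Finset.sum_range_succ', Finset.sum_range_succ']
  simp only [map_add, map_sum, map_smul, ← Module.End.mul_apply, ← pow_succ']
  simp only [zero_add, Nat.factorial_zero, Nat.factorial_one, Nat.cast_one, inv_one, one_smul,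
    pow_zero, pow_one, Module.End.one_apply]
  abel

theorem inv_factorial_smul_pow_apply_mul_of_leibniz (hL : ∀ a b, L (a * b) = L a * b + a * D b)
    {m : ℕ} (hm : (m.factorial : k) ≠ 0) (a b : A) : (m.factorial : k)⁻¹ • (L ^ m) (a * b) =
      ∑ i ∈ Finset.range (m + 1), (i.factorial : k)⁻¹ • (L ^ i) a *
        ((m - i).factorial : k)⁻¹ • (D ^ (m - i)) b := by
  rw [pow_apply_mul_of_leibniz hL, Finset.Nat.sum_antidiagonal_eq_sum_range_succ
    (fun i j => m.choose i • ((L ^ i) a * (D ^ j) b)), Finset.smul_sum]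
  refine Finset.sum_congr rfl fun i hi => ?_
  have him : i ≤ m := Nat.lt_succ_iff.mp (Finset.mem_range.mp hi)
  have hchoose : (m.choose i : k) * i.factorial * (m - i).factorial = m.factorial := by
    rw [← Nat.choose_mul_factorial_mul_factorial him, Nat.cast_mul, Nat.cast_mul]
  have hi0 := cast_factorial_ne_zero_of_le him hm
  have hmi0 := cast_factorial_ne_zero_of_le (m.sub_le i) hm
  rw [smul_mul_smul_comm, ← Nat.cast_smul_eq_nsmul k, smul_smul]
  congr 1
  field_simp
  linear_combination hchoose

theorem truncExp_apply_mul_of_leibniz (hL : ∀ a b, L (a * b) = L a * b + a * D b) {d : ℕ}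
    (hd : (d.factorial : k) ≠ 0) (a b : A) : truncExp d L (a * b) =
      ∑ i ∈ Finset.range (d + 1), ∑ j ∈ Finset.range (d + 1 - i),
        (i.factorial : k)⁻¹ • (L ^ i) a * (j.factorial : k)⁻¹ • (D ^ j) b := by
  rw [truncExp_apply, ← Finset.sum_range_diag_flip (d + 1) fun i j =>
    (i.factorial : k)⁻¹ • (L ^ i) a * (j.factorial : k)⁻¹ • (D ^ j) b]
  exact Finset.sum_congr rfl fun m hm => inv_factorial_smul_pow_apply_mul_of_leibniz hL
    (cast_factorial_ne_zero_of_le (Nat.lt_succ_iff.mp (Finset.mem_range.mp hm)) hd) a b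

theorem truncExp_apply_mul_sub_mem (hL : ∀ a b, L (a * b) = L a * b + a * D b)
    (hLJ : RaisesAdicOrder J L) (hDJ : RaisesAdicOrder J D) {d : ℕ}
    (hd : (d.factorial : k) ≠ 0) (a b : A) :
    truncExp d L (a * b) - truncExp d L a * truncExp d D b ∈ J ^ (d + 1) := by
  rw [truncExp_apply_mul_of_leibniz hL hd, truncExp_apply, truncExp_apply, Finset.sum_mul_sum,
    ← Finset.sum_sub_distrib]
  refine Ideal.sum_mem _ fun i _ => ?_
  rw [← neg_sub, ← Finset.sum_Ico_eq_sub _ (Nat.sub_le _ _)]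
  refine neg_mem (Ideal.sum_mem _ fun j hj => ?_)
  have hij : d + 1 ≤ i + j := by have := (Finset.mem_Ico.mp hj).1; omega
  have hLi : (L ^ i) a ∈ J ^ i := by simpa using hLJ.pow_apply_mem i (j := 0) (a := a) (by simp)
  have hDj : (D ^ j) b ∈ J ^ j := by simpa using hDJ.pow_apply_mem j (j := 0) (a := b) (by simp)
  refine Ideal.pow_le_pow_right hij ?_
  rw [pow_add]
  exact Ideal.mul_mem_mul (Submodule.smul_of_tower_mem _ _ hLi)
    (Submodule.smul_of_tower_mem _ _ hDj)

end TruncExp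

section LinearAlgebra

variable {k U V W : Type*} [Field k] [AddCommGroup U] [Module k U] [AddCommGroup V] [Module k V]
  [AddCommGroup W] [Module k W]

theorem exists_comp_eq_of_ker_le {f : V →ₗ[k] U} {g : V →ₗ[k] W}
    (hker : LinearMap.ker f ≤ LinearMap.ker g) : ∃ h : U →ₗ[k] W, h ∘ₗ f = g := by
  obtain ⟨h, hh⟩ := LinearMap.exists_extend
    ((LinearMap.ker f).liftQ g hker ∘ₗ f.quotKerEquivRange.symm.toLinearMap)
  refine ⟨h, LinearMap.ext fun v => ?_⟩
  have := LinearMap.congr_fun hh ⟨f v, LinearMap.mem_range_self f v⟩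
  simpa [LinearMap.quotKerEquivRange_symm_apply_image] using this

variable [FiniteDimensional k U]

theorem surjective_and_ker_eq_of_ker_le {f : V →ₗ[k] U} {g : V →ₗ[k] W}
    (hg : Function.Surjective g) (hker : LinearMap.ker f ≤ LinearMap.ker g)
    (hdim : Module.finrank k U = Module.finrank k W) :
    Function.Surjective f ∧ LinearMap.ker f = LinearMap.ker g := by
  obtain ⟨h, rfl⟩ := exists_comp_eq_of_ker_le hker
  have hsurj : Function.Surjective h := Function.Surjective.of_comp hg
  have : FiniteDimensional k W := Module.Finite.of_surjective h hsurj
  have hinj := (LinearMap.injective_iff_surjective_of_finrank_eq_finrank hdim).mpr hsurj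
  exact ⟨Function.Surjective.of_comp_left hg hinj,
    (LinearMap.ker_comp_of_ker_eq_bot f (LinearMap.ker_eq_bot.mpr hinj)).symm⟩

end LinearAlgebra

section PowerSeries

theorem span_range_X_map_toAdicCompletionAlgEquiv (ι R : Type*) [Finite ι] [CommRing R] :
    (Ideal.span (Set.range (X : ι → MvPowerSeries ι R))).map
      (toAdicCompletionAlgEquiv ι R).toRingEquiv =
    (MvPolynomial.idealOfVars ι R).map
      (algebraMap _ (AdicCompletion (MvPolynomial.idealOfVars ι R) (MvPolynomial ι R))) := by
  simp_rw [Ideal.map_span, ← Set.range_comp]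
  congr 2
  ext1 i
  simp [AdicCompletion.algebraMap_apply, ← MvPolynomial.coe_X, toAdicCompletion_coe]

theorem mem_span_range_X_pow_iff {ι R : Type*} [Finite ι] [CommRing R] {j : ℕ}
    {σ : MvPowerSeries ι R} : σ ∈ Ideal.span (Set.range X) ^ j ↔
      ∀ a : ι →₀ ℕ, a.degree < j → coeff a σ = 0 := by
  let e := (toAdicCompletionAlgEquiv ι R).toRingEquiv
  calc
    σ ∈ Ideal.span (Set.range X) ^ j ↔ e σ ∈ (Ideal.span (Set.range X) ^ j).map e := by
      rw [← Ideal.comap_symm, Ideal.mem_comap, RingEquiv.symm_apply_apply]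
    _ ↔ e σ ∈ (MvPolynomial.idealOfVars ι R ^ j • ⊤ : Submodule (MvPolynomial ι R)
          (AdicCompletion (MvPolynomial.idealOfVars ι R) (MvPolynomial ι R))) := by
      rw [Ideal.map_pow, span_range_X_map_toAdicCompletionAlgEquiv, ← Ideal.map_pow,
        Ideal.smul_top_eq_map]
      rfl
    _ ↔ truncTotal j σ ∈ MvPolynomial.idealOfVars ι R ^ j := by
      rw [AdicCompletion.pow_smul_top_eq_ker_eval (MvPolynomial.idealOfVars_fg ι R),
        LinearMap.mem_ker, AdicCompletion.eval_apply]
      change (toAdicCompletion ι R σ).val j = 0 ↔ _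
      rw [toAdicCompletion_apply_eq_mk_truncTotal]
      change Submodule.Quotient.mk _ = 0 ↔ _
      rw [Submodule.Quotient.mk_eq_zero, smul_eq_mul, Ideal.mul_top]
    _ ↔ ∀ a : ι →₀ ℕ, a.degree < j → coeff a σ = 0 := by
      rw [MvPolynomial.mem_pow_idealOfVars_iff']
      exact forall₂_congr fun a ha => by rw [coeff_truncTotal _ ha]

end PowerSeries

variable {k : Type*} [Field k] {n : ℕ}

theorem mem_mS_iff {σ : S k n} : σ ∈ mS k n ↔ constantCoeff σ = 0 := by
  rw [IsLocalRing.mem_maximalIdeal, mem_nonunits_iff, isUnit_iff_constantCoeff, isUnit_iff_ne_zero,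
    not_not]

theorem X_mem_mS (i : Fin n) : (X i : S k n) ∈ mS k n := by
  rw [mem_mS_iff, constantCoeff_X]

theorem sub_C_constantCoeff_mem_mS (σ : S k n) : σ - C (constantCoeff σ) ∈ mS k n := by
  rw [mem_mS_iff, map_sub, constantCoeff_C, sub_self]

variable (k n) in
theorem mS_eq_span_range_X : mS k n = Ideal.span (Set.range X) := by
  ext σ
  rw [← pow_one (Ideal.span _), mem_span_range_X_pow_iff, mem_mS_iff,
    ← coeff_zero_eq_constantCoeff_apply]
  simp [Finsupp.degree_eq_zero_iff]

theorem mem_mS_pow_iff {j : ℕ} {σ : S k n} :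
    σ ∈ mS k n ^ j ↔ ∀ a : Fin n →₀ ℕ, a.degree < j → coeff a σ = 0 := by
  rw [mS_eq_span_range_X, mem_span_range_X_pow_iff]

instance : IsAdicComplete (mS k n) (S k n) := by
  rw [mS_eq_span_range_X]
  infer_instance

theorem monomial_mem_mS_pow (a : Fin n →₀ ℕ) (c : k) {j : ℕ} (h : j ≤ a.degree) :
    (monomial a c : S k n) ∈ mS k n ^ j := by
  classical
  rw [mem_mS_pow_iff]
  intro b hb
  rw [coeff_monomial, if_neg]
  rintro rfl
  omega

theorem sub_truncTotal_mem_mS_pow (e : ℕ) (σ : S k n) :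
    σ - (truncTotal e σ : MvPolynomial (Fin n) k) ∈ mS k n ^ e := by
  rw [mem_mS_pow_iff]
  intro a ha
  rw [map_sub, MvPolynomial.coeff_coe, coeff_truncTotal _ ha, sub_self]

theorem linearMap_ext_of_comp_coe_eq {V : Type*} [AddCommGroup V] [Module k V] {e : ℕ}
    {M N : S k n →ₗ[k] V} (hM : ∀ σ ∈ mS k n ^ e, M σ = 0) (hN : ∀ σ ∈ mS k n ^ e, N σ = 0)
    (h : ∀ p : MvPolynomial (Fin n) k, M p = N p) : M = N := by
  ext σ
  have hMσ := hM _ (sub_truncTotal_mem_mS_pow e σ)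
  have hNσ := hN _ (sub_truncTotal_mem_mS_pow e σ)
  rw [map_sub, sub_eq_zero] at hMσ hNσ
  rw [hMσ, hNσ, h]

theorem linearMap_ext_of_monomial {V : Type*} [AddCommGroup V] [Module k V] {e : ℕ}
    {M N : S k n →ₗ[k] V} (hM : ∀ σ ∈ mS k n ^ e, M σ = 0) (hN : ∀ σ ∈ mS k n ^ e, N σ = 0)
    (h : ∀ a : Fin n →₀ ℕ, M (monomial a 1) = N (monomial a 1)) : M = N := by
  let coe : MvPolynomial (Fin n) k →ₗ[k] S k n :=
    (MvPolynomial.coeToMvPowerSeries.algHom k).toLinearMap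
  have hcoe : M ∘ₗ coe = N ∘ₗ coe :=
    MvPolynomial.linearMap_ext fun a => LinearMap.ext_ring (by simpa [coe] using h a)
  exact linearMap_ext_of_comp_coe_eq hM hN fun p => by
    simpa [coe] using LinearMap.congr_fun hcoe p

theorem algHom_ext_of_X {B : Type*} [CommRing B] [Algebra k B] {e : ℕ} {φ ψ : S k n →ₐ[k] B}
    (hφ : ∀ σ ∈ mS k n ^ e, φ σ = 0) (hψ : ∀ σ ∈ mS k n ^ e, ψ σ = 0)
    (h : ∀ i, φ (X i) = ψ (X i)) : φ = ψ := by
  let coe : MvPolynomial (Fin n) k →ₐ[k] S k n := MvPolynomial.coeToMvPowerSeries.algHom k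
  have hcoe : φ.comp coe = ψ.comp coe := MvPolynomial.algHom_ext fun i => by simpa [coe] using h i
  exact AlgHom.toLinearMap_injective <| linearMap_ext_of_comp_coe_eq (M := φ.toLinearMap)
    (N := ψ.toLinearMap) hφ hψ fun p => by simpa [coe] using AlgHom.congr_fun hcoe p

theorem raisesAdicOrder_of_twisted_leibniz {N : Module.End k (S k n)} {φ : S k n → S k n}
    (hφ : ∀ σ ∈ mS k n, φ σ ∈ mS k n) (hmul : ∀ σ τ, N (σ * τ) = N σ * φ τ + σ * N τ)
    (hone : N 1 = 0) (hX : ∀ i, N (X i) ∈ mS k n ^ 2) : RaisesAdicOrder (mS k n) N := by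
  have hconst : ∀ σ : S k n, ∃ c : k, σ - algebraMap k (S k n) c ∈ mS k n := fun σ =>
    ⟨constantCoeff σ, by simpa [MvPowerSeries.algebraMap_apply] using sub_C_constantCoeff_mem_mS σ⟩
  rw [mS_eq_span_range_X] at *
  exact .of_twisted_leibniz hconst hφ hmul hone (Set.forall_mem_range.mpr hX)

theorem raisesAdicOrder_derivation {D : Derivation k (S k n) (S k n)}
    (hD : ∀ i, D (X i) ∈ mS k n ^ 2) : RaisesAdicOrder (mS k n) (D : S k n →ₗ[k] S k n) :=
  raisesAdicOrder_of_twisted_leibniz (φ := id) (fun _ => id)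
    (fun σ τ => by simp only [Derivation.coeFn_coe, Derivation.leibniz, smul_eq_mul, id]; ring)
    D.map_one_eq_zero hD

theorem raisesAdicOrder_one_sub_algHom {φ : S k n →ₐ[k] S k n}
    (hφ : ∀ i, φ (X i) - X i ∈ mS k n ^ 2) : RaisesAdicOrder (mS k n) (1 - φ.toLinearMap) := by
  have hmap : mS k n ≤ (mS k n).comap φ := by
    conv_lhs => rw [mS_eq_span_range_X]
    rw [Ideal.span_le]
    rintro _ ⟨i, rfl⟩
    simpa using add_mem (Ideal.pow_le_self two_ne_zero (hφ i)) (X_mem_mS i)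
  refine raisesAdicOrder_of_twisted_leibniz (φ := φ) (fun σ hσ => hmap hσ) (fun σ τ => ?_) ?_
    fun i => ?_
  · simp only [LinearMap.sub_apply, Module.End.one_apply, AlgHom.toLinearMap_apply, map_mul]
    ring
  · simp
  · simpa using neg_mem (hφ i)

theorem exists_mem_AutPlus_apply_X {y : Fin n → S k n} (hy : ∀ i, y i - X i ∈ mS k n ^ 2) :
    ∃ φ ∈ AutPlus k n, ∀ i, φ (X i) = y i := by
  have hsubst : HasSubst y := hasSubst_of_constantCoeff_zero fun i => by
    rw [← mem_mS_iff]
    simpa using add_mem (Ideal.pow_le_self two_ne_zero (hy i)) (X_mem_mS i)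
  have hX : ∀ i, substAlgHom (R := k) hsubst (X i) = y i := substAlgHom_X hsubst
  have hbij : Function.Bijective (substAlgHom (R := k) hsubst) := by
    have hraises := raisesAdicOrder_one_sub_algHom (φ := substAlgHom hsubst)
      fun i => by rw [hX]; exact hy i
    simpa using hraises.bijective_one_sub
  exact ⟨AlgEquiv.ofBijective _ hbij, fun i => by simpa [hX] using hy i, hX⟩

theorem exists_mem_AutPlus_sub_truncExp_mem {D : Derivation k (S k n) (S k n)}
    (hD : ∀ i, D (X i) ∈ mS k n ^ 2) {d : ℕ} (hd : (d.factorial : k) ≠ 0) :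
    ∃ φ ∈ AutPlus k n, ∀ σ,
      φ σ - truncExp d (D : S k n →ₗ[k] S k n) σ ∈ mS k n ^ (d + 1) := by
  set E := truncExp d (D : S k n →ₗ[k] S k n)
  have hraises := raisesAdicOrder_derivation hD
  obtain ⟨φ, hφ, hφX⟩ := exists_mem_AutPlus_apply_X (y := fun i => E (X i)) fun i =>
    hraises.truncExp_apply_sub_self_mem d (j := 1) (by simpa using X_mem_mS i)
  let π := Ideal.Quotient.mkₐ k (mS k n ^ (d + 1))
  have hπ : ∀ {σ}, σ ∈ mS k n ^ (d + 1) → π σ = 0 := Ideal.Quotient.eq_zero_iff_mem.mpr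
  let πE : S k n →ₐ[k] S k n ⧸ mS k n ^ (d + 1) := AlgHom.ofLinearMap (π.toLinearMap ∘ₗ E)
    (by simpa using congrArg π (truncExp_apply_of_apply_eq_zero d (D.map_one_eq_zero)))
    fun σ τ => (Ideal.Quotient.eq.mpr (truncExp_apply_mul_sub_mem (fun a b => by
      simp only [Derivation.coeFn_coe, Derivation.leibniz, smul_eq_mul]; ring)
      hraises hraises hd σ τ)).trans (map_mul π _ _)
  have hφE : π.comp (φ : S k n →ₐ[k] S k n) = πE := algHom_ext_of_X (e := d + 1)
    (fun σ hσ => hπ (map_mem_pow φ _ hσ)) (fun σ hσ => hπ (hraises.truncExp_apply_mem d hσ))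
    fun i => congrArg π (hφX i)
  exact ⟨φ, hφ, fun σ => Ideal.Quotient.eq.mp (AlgHom.congr_fun hφE σ)⟩

variable (k n) in
/-- The Lie algebra of `G⁺`: the operators `σ ↦ s σ + D σ` with `s ∈ 𝔪` and `D` a `k`-linear
derivation of `S` such that `D αᵢ ∈ 𝔪²` for all `i`. -/
def lieGPlus : Submodule k (Module.End k (S k n)) where
  carrier := {M | ∃ s ∈ mS k n, ∃ D : Derivation k (S k n) (S k n),
    (∀ i, D (X i) ∈ mS k n ^ 2) ∧ M = LinearMap.mulLeft k s + (D : S k n →ₗ[k] S k n)}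
  zero_mem' := ⟨0, zero_mem _, 0, fun _ => by simp, by ext; simp⟩
  add_mem' := by
    rintro _ _ ⟨s, hs, D, hD, rfl⟩ ⟨s', hs', D', hD', rfl⟩
    refine ⟨s + s', add_mem hs hs', D + D', fun i => add_mem (hD i) (hD' i), ?_⟩
    ext1 σ
    simp only [LinearMap.add_apply, LinearMap.mulLeft_apply, Derivation.coeFn_coe,
      Derivation.add_apply]
    ring
  smul_mem' := by
    rintro c _ ⟨s, hs, D, hD, rfl⟩
    refine ⟨c • s, Submodule.smul_of_tower_mem _ c hs, c • D,
      fun i => Submodule.smul_of_tower_mem _ c (hD i), ?_⟩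
    ext1 σ
    simp

theorem mulLeft_mem_lieGPlus {s : S k n} (hs : s ∈ mS k n) :
    LinearMap.mulLeft k s ∈ lieGPlus k n :=
  ⟨s, hs, 0, fun _ => by simp, by ext; simp⟩

theorem smul_pderiv_mem_lieGPlus {τ : S k n} (hτ : τ ∈ mS k n ^ 2) (i : Fin n) :
    ((τ • pderiv k i : Derivation k (S k n) (S k n)) : S k n →ₗ[k] S k n) ∈ lieGPlus k n :=
  ⟨0, zero_mem _, τ • pderiv k i, fun _ => Ideal.mul_mem_right _ _ hτ, by ext; simp⟩

theorem raisesAdicOrder_of_mem_lieGPlus {M : Module.End k (S k n)} (hM : M ∈ lieGPlus k n) :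
    RaisesAdicOrder (mS k n) M := by
  obtain ⟨s, hs, D, hD, rfl⟩ := hM
  exact (RaisesAdicOrder.mulLeft hs).add (raisesAdicOrder_derivation hD)

theorem exists_mem_GPlus_sub_truncExp_mem {M : Module.End k (S k n)} (hM : M ∈ lieGPlus k n)
    {d : ℕ} (hd : (d.factorial : k) ≠ 0) :
    ∃ L ∈ GPlus k n, ∀ σ, L σ - truncExp d M σ ∈ mS k n ^ (d + 1) := by
  have hraises := raisesAdicOrder_of_mem_lieGPlus hM
  obtain ⟨s, -, D, hD, rfl⟩ := hM
  set M : Module.End k (S k n) := LinearMap.mulLeft k s + (D : S k n →ₗ[k] S k n) with hMdef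
  obtain ⟨φ, hφ, hφE⟩ := exists_mem_AutPlus_sub_truncExp_mem hD hd
  have hsub : truncExp d M 1 - 1 ∈ mS k n := by
    simpa using hraises.truncExp_apply_sub_self_mem d (j := 0) (a := 1) (by simp)
  obtain ⟨u, hu⟩ := isUnit_of_sub_one_mem hsub
  have hbij : Function.Bijective (LinearMap.mulLeft k (u : S k n) ∘ₗ φ.toLinearMap) :=
    (Units.mulLeft_bijective u).comp φ.bijective
  refine ⟨LinearEquiv.ofBijective _ hbij, ⟨φ, hφ, u, by rwa [hu], fun _ => rfl⟩, fun σ => ?_⟩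
  have hmul := truncExp_apply_mul_sub_mem (L := M) (D := (D : S k n →ₗ[k] S k n)) (fun a b => by
    simp only [hMdef, LinearMap.add_apply, LinearMap.mulLeft_apply, Derivation.coeFn_coe,
      Derivation.leibniz, smul_eq_mul]
    ring) hraises (raisesAdicOrder_derivation hD) hd 1 σ
  rw [one_mul, ← hu] at hmul
  have hdiff := sub_mem (Ideal.mul_mem_left _ (u : S k n) (hφE σ)) hmul
  rwa [mul_sub, sub_sub_sub_cancel_right] at hdiff

section Duality

variable (k n) in
/-- The embedding `f ↦ ⟨·, f⟩` of `P` into the dual space of `S`. -/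
noncomputable def toDual : P k n →ₗ[k] Module.Dual k (S k n) :=
  Finsupp.linearCombination k fun a => (coeff a : S k n →ₗ[k] k)

@[simp]
theorem toDual_apply (f : P k n) (σ : S k n) : toDual k n f σ = pairing σ f := by
  simp [toDual, pairing, Finsupp.linearCombination_apply, Finsupp.sum, mul_comm]

theorem toDual_injective : Function.Injective (toDual k n) := fun f g h =>
  eq_of_pairing_eq fun σ => by simpa using LinearMap.congr_fun h σ

theorem flip_toDual_surjective : Function.Surjective (toDual k n).flip := by
  intro ℓ
  let σ : S k n := fun a => ℓ (Finsupp.single a 1)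
  refine ⟨σ, Finsupp.lhom_ext' fun a => LinearMap.ext_ring ?_⟩
  change (toDual k n).flip σ (Finsupp.single a 1) = ℓ (Finsupp.single a 1)
  rw [LinearMap.flip_apply, toDual_apply, pairing_single, mul_one, coeff_apply]

theorem mem_Ann_iff {f : P k n} {σ : S k n} : σ ∈ Ann f ↔ ∀ τ, pairing (τ * σ) f = 0 := by
  change contract σ f = 0 ↔ _
  simp_rw [← pairing_contract, ← toDual_apply]
  refine ⟨fun h τ => by simp [h], fun h => toDual_injective ?_⟩
  ext τ
  simpa using h τ

theorem le_Ann_iff {J : Ideal (S k n)} {f : P k n} : J ≤ Ann f ↔ ∀ σ ∈ J, pairing σ f = 0 :=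
  ⟨fun h σ hσ => by simpa using mem_Ann_iff.mp (h hσ) 1,
    fun h σ hσ => mem_Ann_iff.mpr fun τ => h _ (Ideal.mul_mem_left _ τ hσ)⟩

theorem mem_colon_Ann_iff {J : Ideal (S k n)} {f : P k n} {σ : S k n} :
    σ ∈ (Ann f).colon J ↔ ∀ τ ∈ J, pairing (τ * σ) f = 0 := by
  simp_rw [Submodule.mem_colon, smul_eq_mul, mul_comm σ]
  refine ⟨fun h τ hτ => by simpa using mem_Ann_iff.mp (h τ hτ) 1, fun h τ hτ => ?_⟩
  exact mem_Ann_iff.mpr fun ρ => by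
    rw [← mul_assoc]
    exact h _ (Ideal.mul_mem_left _ ρ hτ)

theorem mS_pow_le_Ann_iff {e : ℕ} {f : P k n} :
    mS k n ^ e ≤ Ann f ↔ ∀ a, f a ≠ 0 → a.degree < e := by
  rw [le_Ann_iff]
  constructor
  · intro h a ha
    by_contra! hlt
    exact ha (by rw [← pairing_monomial, h _ (monomial_mem_mS_pow a 1 hlt)])
  · intro h σ hσ
    refine Finset.sum_eq_zero fun a ha => ?_
    simp only [mem_mS_pow_iff.mp hσ a (h a (Finsupp.mem_support_iff.mp ha)), zero_mul]

theorem mS_pow_add_one_le_Ann_of_mem_PLE {f : P k n} {e : ℕ} (hf : f ∈ PLE k n e) :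
    mS k n ^ (e + 1) ≤ Ann f :=
  mS_pow_le_Ann_iff.mpr fun _ ha => Nat.lt_succ_of_le (hf (Finsupp.mem_support_iff.mpr ha))

theorem mS_pow_deg_add_one_le_Ann (f : P k n) : mS k n ^ (deg f + 1) ≤ Ann f :=
  mS_pow_add_one_le_Ann_of_mem_PLE fun _ ha => Finset.le_sup (f := Finsupp.degree) ha

theorem exists_toDual_eq {ℓ : Module.Dual k (S k n)} {e : ℕ} (h : ∀ σ ∈ mS k n ^ e, ℓ σ = 0) :
    ∃ g, toDual k n g = ℓ := by
  have hdegree : ∀ a : Fin n →₀ ℕ, ℓ (monomial a 1) ≠ 0 → a.degree < e := fun a ha => by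
    by_contra! hlt
    exact ha (h _ (monomial_mem_mS_pow a 1 hlt))
  let g : P k n := Finsupp.ofSupportFinite (fun a => ℓ (monomial a 1))
    ((Finsupp.finite_of_degree_le e).subset fun a ha => (hdegree a ha).le)
  refine ⟨g, linearMap_ext_of_monomial (e := e) (fun σ hσ => ?_) h fun a => ?_⟩
  · rw [toDual_apply]
    exact le_Ann_iff.mp (mS_pow_le_Ann_iff.mpr hdegree) σ hσ
  · rw [toDual_apply, pairing_monomial]
    rfl

end Duality

section Orbit

theorem comap_mS_pow (φ : S k n ≃ₐ[k] S k n) (j : ℕ) :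
    (mS k n ^ j).comap φ = mS k n ^ j := by
  refine le_antisymm (fun σ hσ => ?_) fun σ hσ => map_mem_pow φ j hσ
  simpa using map_mem_pow φ.symm j hσ

theorem self_mem_orbitPlus (f : P k n) : f ∈ orbitPlus f :=
  ⟨1, one_mem _, fun _ => rfl⟩

theorem orbitPlus_trans {f g h : P k n} (hg : g ∈ orbitPlus f) (hh : h ∈ orbitPlus g) :
    h ∈ orbitPlus f := by
  obtain ⟨L, hL, hLg⟩ := hg
  obtain ⟨M, hM, hMh⟩ := hh
  exact ⟨L * M, mul_mem hL hM, fun σ => (hMh σ).trans (hLg (M σ))⟩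

theorem exists_Ann_eq_comap_of_mem_orbitPlus {f g : P k n} (hg : g ∈ orbitPlus f) :
    ∃ φ : S k n ≃ₐ[k] S k n, Ann g = (Ann f).comap φ := by
  obtain ⟨L, ⟨φ, -, s, hs, hL⟩, hg⟩ := hg
  obtain ⟨u, rfl⟩ := isUnit_of_sub_one_mem hs
  refine ⟨φ, Ideal.ext fun σ => ?_⟩
  have hsurj : Function.Surjective fun τ => u * φ τ :=
    (Units.mulLeft_bijective u).surjective.comp φ.surjective
  rw [Ideal.mem_comap, mem_Ann_iff, mem_Ann_iff]
  refine Iff.trans (forall_congr' fun τ => ?_) hsurj.forall.symm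
  rw [hg, hL, map_mul, mul_assoc]

theorem mS_pow_le_Ann_of_mem_orbitPlus {f g : P k n} (hg : g ∈ orbitPlus f) {e : ℕ}
    (hf : mS k n ^ e ≤ Ann f) : mS k n ^ e ≤ Ann g := by
  obtain ⟨φ, hφ⟩ := exists_Ann_eq_comap_of_mem_orbitPlus hg
  rw [hφ, ← comap_mS_pow φ e]
  exact Ideal.comap_mono hf

theorem colon_Ann_le_of_mem_orbitPlus {f g : P k n} (hg : g ∈ orbitPlus f) {i j : ℕ}
    (hf : (Ann f).colon (mS k n ^ i : Ideal (S k n)) ≤ mS k n ^ j) :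
    (Ann g).colon (mS k n ^ i : Ideal (S k n)) ≤ mS k n ^ j := by
  obtain ⟨φ, hφ⟩ := exists_Ann_eq_comap_of_mem_orbitPlus hg
  intro σ hσ
  rw [← comap_mS_pow φ j]
  refine hf (Submodule.mem_colon.mpr fun τ hτ => ?_)
  have hτ' : φ.symm τ ∈ mS k n ^ i := map_mem_pow φ.symm i hτ
  have := Submodule.mem_colon.mp hσ _ hτ'
  simpa [hφ] using this

theorem apolar_algEquiv_of_mem_orbitPlus {f g : P k n} (hg : g ∈ orbitPlus f) :
    Nonempty (Apolar f ≃ₐ[k] Apolar g) := by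
  obtain ⟨φ, hφ⟩ := exists_Ann_eq_comap_of_mem_orbitPlus hg
  exact ⟨(Ideal.quotientEquivAlg (Ann g) (Ann f) φ
    (by rw [hφ]; exact (Ideal.map_comap_of_surjective _ φ.surjective _).symm)).symm⟩

end Orbit

section TangentSpace

/-- The tangent space at `f` to the orbit of `f` under `G⁺`: the image of `f` under the transposes
of the operators in the Lie algebra of `G⁺`. -/
noncomputable def tangentSpace (f : P k n) : Submodule k (P k n) :=
  ((lieGPlus k n).map (LinearMap.compRight k (toDual k n f))).comap (toDual k n)

theorem mem_tangentSpace_iff {f h : P k n} :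
    h ∈ tangentSpace f ↔ ∃ M ∈ lieGPlus k n, ∀ σ, pairing σ h = pairing (M σ) f := by
  simp [tangentSpace, LinearMap.ext_iff, eq_comm]

theorem exists_pairing_eq_pairing_apply {f : P k n} {M : Module.End k (S k n)} {d : ℕ}
    (hM : ∀ σ ∈ mS k n ^ d, pairing (M σ) f = 0) :
    ∃ g, ∀ σ, pairing σ g = pairing (M σ) f := by
  obtain ⟨g, hg⟩ := exists_toDual_eq (ℓ := toDual k n f ∘ₗ M) (e := d) (by simpa using hM)
  exact ⟨g, fun σ => by simpa using LinearMap.congr_fun hg σ⟩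

theorem mem_mS_pow_succ_of_pderiv_mem {σ : S k n} {j : ℕ} (hj : (j.factorial : k) ≠ 0)
    (hσ : σ ∈ mS k n) (hpderiv : ∀ i, pderiv k i σ ∈ mS k n ^ j) : σ ∈ mS k n ^ (j + 1) := by
  refine mem_mS_pow_iff.mpr fun a ha => ?_
  obtain rfl | ha0 := eq_or_ne a 0
  · rw [coeff_zero_eq_constantCoeff_apply, mem_mS_iff.mp hσ]
  obtain ⟨i, hi⟩ := Finsupp.ne_iff.mp ha0
  obtain ⟨b, rfl⟩ : ∃ b, a = b + Finsupp.single i 1 := ⟨a - Finsupp.single i 1,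
    (tsub_add_cancel_of_le (Finsupp.single_le_iff.mpr (Nat.one_le_iff_ne_zero.mpr hi))).symm⟩
  have hb : b.degree < j := by simpa using ha
  have hcoeff := mem_mS_pow_iff.mp (hpderiv i) b hb
  rw [coeff_pderiv] at hcoeff
  have hbi : b i + 1 ≤ j := (Finsupp.le_degree i b).trans_lt hb
  have hcast : ((b i + 1 : ℕ) : k) ≠ 0 := by
    have := cast_factorial_ne_zero_of_le hbi hj
    rw [Nat.factorial_succ, Nat.cast_mul] at this
    exact left_ne_zero_of_mul this
  exact (mul_eq_zero.mp hcoeff).resolve_right (by exact_mod_cast hcast)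

theorem mem_mS_pow_of_forall_lieGPlus {f : P k n} {σ : S k n} {j : ℕ} (hj0 : j ≠ 0)
    (hj : (j.factorial : k) ≠ 0) (hcolon : (Ann f).colon (mS k n ^ 2 : Ideal (S k n)) ≤ mS k n ^ j)
    (hσ : ∀ M ∈ lieGPlus k n, pairing (M σ) f = 0) : σ ∈ mS k n ^ (j + 1) := by
  refine mem_mS_pow_succ_of_pderiv_mem hj ?_ fun i => hcolon (mem_colon_Ann_iff.mpr fun τ hτ => ?_)
  · rw [IsLocalRing.mem_maximalIdeal, mem_nonunits_iff]
    rintro ⟨u, rfl⟩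
    have hone : (1 : S k n) ∈ mS k n ^ j := hcolon (mem_colon_Ann_iff.mpr fun τ hτ => by
      have hτu : τ * (↑u⁻¹ : S k n) ∈ mS k n :=
        Ideal.mul_mem_right _ _ (Ideal.pow_le_self two_ne_zero hτ)
      simpa using hσ _ (mulLeft_mem_lieGPlus hτu))
    exact (Ideal.ne_top_iff_one _).mp Ideal.IsPrime.ne_top' (Ideal.pow_le_self hj0 hone)
  · simpa using hσ _ (smul_pderiv_mem_lieGPlus hτ i)

theorem mem_tangentSpace_of_mS_pow_le_Ann {f h : P k n} {j : ℕ} (hj0 : j ≠ 0)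
    (hj : (j.factorial : k) ≠ 0) (hcolon : (Ann f).colon (mS k n ^ 2 : Ideal (S k n)) ≤ mS k n ^ j)
    (hh : mS k n ^ (j + 1) ≤ Ann h) : h ∈ tangentSpace f := by
  by_contra hnot
  obtain ⟨ℓ, hℓh, hℓ⟩ := Submodule.exists_le_ker_of_notMem hnot
  obtain ⟨σ, rfl⟩ := flip_toDual_surjective ℓ
  refine hℓh ?_
  rw [LinearMap.flip_apply, toDual_apply]
  refine le_Ann_iff.mp hh σ (mem_mS_pow_of_forall_lieGPlus hj0 hj hcolon fun M hM => ?_)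
  obtain ⟨g, hg⟩ := exists_pairing_eq_pairing_apply (f := f) (M := M) (d := deg f + 1)
    fun τ hτ => le_Ann_iff.mp (mS_pow_deg_add_one_le_Ann f) _
      (Ideal.pow_le_pow_right (Nat.le_succ _) (raisesAdicOrder_of_mem_lieGPlus hM hτ))
  have hker := hℓ (mem_tangentSpace_iff.mpr ⟨M, hM, hg⟩)
  rwa [LinearMap.mem_ker, LinearMap.flip_apply, toDual_apply, hg] at hker

theorem exists_mem_orbitPlus_mS_pow_le_Ann_sub {f h : P k n} {d e : ℕ} (hd0 : d ≠ 0)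
    (hd : (d.factorial : k) ≠ 0) (hf : mS k n ^ (d + 1) ≤ Ann f) (hh : h ∈ tangentSpace f)
    (he : mS k n ^ (e + 1) ≤ Ann h) : ∃ g ∈ orbitPlus f, mS k n ^ e ≤ Ann (f + h - g) := by
  obtain ⟨M, hM, hMh⟩ := mem_tangentSpace_iff.mp hh
  have hraises := raisesAdicOrder_of_mem_lieGPlus hM
  obtain ⟨L, hL, hLM⟩ := exists_mem_GPlus_sub_truncExp_mem hM hd
  have hpairing : ∀ σ, pairing (L σ) f = pairing (truncExp d M σ) f := fun σ => by
    have := le_Ann_iff.mp hf _ (hLM σ)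
    rwa [← toDual_apply, map_sub, sub_eq_zero, toDual_apply, toDual_apply] at this
  obtain ⟨g, hg⟩ := exists_pairing_eq_pairing_apply (f := f) (M := (L : S k n →ₗ[k] S k n))
    fun σ hσ => (hpairing σ).trans (le_Ann_iff.mp hf _ (hraises.truncExp_apply_mem d hσ))
  refine ⟨g, ⟨L, hL, hg⟩, le_Ann_iff.mpr fun σ hσ => ?_⟩
  obtain ⟨ρ, hρ, hexp⟩ := hraises.exists_truncExp_apply_eq hd0 hσ
  have hgσ : pairing σ g = pairing σ f + pairing σ h := calc
    pairing σ g = pairing (σ + M (σ + ρ)) f := by rw [← hexp, ← hpairing]; exact hg σ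
    _ = pairing σ f + (pairing σ h + pairing ρ h) := by
      simp_rw [hMh, ← toDual_apply, map_add]
    _ = pairing σ f + pairing σ h := by rw [le_Ann_iff.mp he ρ hρ, add_zero]
  rw [← toDual_apply, map_sub, map_add, LinearMap.sub_apply, LinearMap.add_apply, toDual_apply,
    toDual_apply, toDual_apply, hgσ, sub_self]

theorem add_mem_orbitPlus {d j : ℕ} (hd : (d.factorial : k) ≠ 0) (hj0 : j ≠ 0) (hjd : j ≤ d)
    {e : ℕ} (hej : e ≤ j + 1) {f h : P k n} (hf : mS k n ^ (d + 1) ≤ Ann f)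
    (hcolon : (Ann f).colon (mS k n ^ 2 : Ideal (S k n)) ≤ mS k n ^ j)
    (hh : mS k n ^ e ≤ Ann h) : f + h ∈ orbitPlus f := by
  induction e generalizing f h with
  | zero =>
    obtain rfl : h = 0 := by
      ext a
      by_contra ha
      exact Nat.not_lt_zero _ (mS_pow_le_Ann_iff.mp hh a ha)
    rw [add_zero]
    exact self_mem_orbitPlus f
  | succ e ih =>
    have htangent := mem_tangentSpace_of_mS_pow_le_Ann hj0 (cast_factorial_ne_zero_of_le hjd hd)
      hcolon ((Ideal.pow_le_pow_right hej).trans hh)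
    obtain ⟨g, hg, hsub⟩ := exists_mem_orbitPlus_mS_pow_le_Ann_sub (by omega) hd hf htangent hh
    have := ih (by omega) (mS_pow_le_Ann_of_mem_orbitPlus hg hf)
      (colon_Ann_le_of_mem_orbitPlus hg hcolon) hsub
    rw [add_sub_cancel] at this
    exact orbitPlus_trans hg this

end TangentSpace

section HilbertFunction

theorem mk_mem_mQuot_pow_iff {I : Ideal (S k n)} {i : ℕ} {σ : S k n} :
    Ideal.Quotient.mk I σ ∈ mQuot I ^ i ↔ σ ∈ mS k n ^ i ⊔ I := by
  rw [mQuot, ← Ideal.map_pow, Ideal.mem_quotient_iff_mem_sup]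

theorem mQuot_pow_eq_bot_iff {I : Ideal (S k n)} {i : ℕ} : mQuot I ^ i = ⊥ ↔ mS k n ^ i ≤ I := by
  rw [mQuot, ← Ideal.map_pow, Ideal.map_eq_bot_iff_le_ker, Ideal.mk_ker]

/-- The projection of `𝔪 ^ i` onto the `i`-th graded piece `𝔪_A ^ i / 𝔪_A ^ (i + 1)` of
`A = S / I`. -/
noncomputable def gradedMk (I : Ideal (S k n)) (i : ℕ) :
    ↥(mS k n ^ i) →ₗ[k] ↥(mQuot I ^ i) ⧸ (mQuot I ^ (i + 1)).submoduleOf (mQuot I ^ i) where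
  toFun σ := Submodule.Quotient.mk
    ⟨Ideal.Quotient.mk I σ, mk_mem_mQuot_pow_iff.mpr (Ideal.mem_sup_left σ.2)⟩
  map_add' _ _ := rfl
  map_smul' _ _ := rfl

theorem gradedMk_surjective (I : Ideal (S k n)) (i : ℕ) : Function.Surjective (gradedMk I i) := by
  intro x
  obtain ⟨⟨y, hy⟩, rfl⟩ := Submodule.Quotient.mk_surjective _ x
  rw [mQuot, ← Ideal.map_pow, Ideal.mem_map_iff_of_surjective _ Ideal.Quotient.mk_surjective] at hy
  obtain ⟨σ, hσ, rfl⟩ := hy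
  exact ⟨⟨σ, hσ⟩, rfl⟩

theorem gradedMk_eq_zero_iff {I : Ideal (S k n)} {i : ℕ} {σ : ↥(mS k n ^ i)} :
    gradedMk I i σ = 0 ↔ (σ : S k n) ∈ mS k n ^ (i + 1) ⊔ I := by
  rw [← mk_mem_mQuot_pow_iff]
  exact Submodule.Quotient.mk_eq_zero _

variable (k n) in
/-- The coefficients of degree `i` of an element of `𝔪 ^ i`, indexed by the monomials of
degree `i`. -/
noncomputable def leadingCoeffs (i : ℕ) :
    ↥(mS k n ^ i) →ₗ[k] ((Finset.univ : Finset (Fin n)).finsuppAntidiag i → k) :=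
  LinearMap.pi fun a => coeff a.1 ∘ₗ (mS k n ^ i).subtype.restrictScalars k

theorem leadingCoeffs_eq_zero_iff {i : ℕ} {σ : ↥(mS k n ^ i)} :
    leadingCoeffs k n i σ = 0 ↔ (σ : S k n) ∈ mS k n ^ (i + 1) := by
  have hdegree : ∀ a : Fin n →₀ ℕ, a ∈ Finset.univ.finsuppAntidiag i ↔ a.degree = i := fun a => by
    simp [Finset.mem_finsuppAntidiag, Finsupp.degree_eq_sum]
  rw [mem_mS_pow_iff, funext_iff, Subtype.forall]
  constructor
  · intro h a ha
    obtain hlt | heq := Nat.lt_succ_iff_lt_or_eq.mp ha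
    · exact mem_mS_pow_iff.mp σ.2 a hlt
    · exact h a ((hdegree a).mpr heq)
  · intro h a ha
    exact h a (((hdegree a).mp ha).trans_lt i.lt_succ_self)

theorem mem_mS_pow_succ_of_hilbertFunction_eq {I : Ideal (S k n)} {i : ℕ}
    (hH : hilbertFunction I i = (i + n - 1).choose i) {σ : S k n} (hσ : σ ∈ mS k n ^ i)
    (hσI : σ ∈ mS k n ^ (i + 1) ⊔ I) : σ ∈ mS k n ^ (i + 1) := by
  have hker : LinearMap.ker (leadingCoeffs k n i) ≤ LinearMap.ker (gradedMk I i) := fun τ hτ =>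
    gradedMk_eq_zero_iff.mpr (Ideal.mem_sup_left (leadingCoeffs_eq_zero_iff.mp hτ))
  have hdim : Module.finrank k ((Finset.univ : Finset (Fin n)).finsuppAntidiag i → k) =
      hilbertFunction I i := by
    rw [hH, Module.finrank_fintype_fun_eq_card, Fintype.card_coe,
      Finset.card_finsuppAntidiag_nat_eq_choose, Finset.card_univ, Fintype.card_fin, add_comm]
  have hker_eq := (surjective_and_ker_eq_of_ker_le (gradedMk_surjective I i) hker hdim).2
  exact leadingCoeffs_eq_zero_iff.mp
    (hker_eq.ge (x := ⟨σ, hσ⟩) (gradedMk_eq_zero_iff.mpr hσI))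

theorem le_mS_pow_of_hilbertFunction_eq {I : Ideal (S k n)} {j : ℕ}
    (hH : ∀ i < j, hilbertFunction I i = (i + n - 1).choose i) : I ≤ mS k n ^ j := by
  induction j with
  | zero => simp
  | succ j ih =>
    intro σ hσ
    exact mem_mS_pow_succ_of_hilbertFunction_eq (hH j j.lt_succ_self)
      (ih (fun i hi => hH i (hi.trans j.lt_succ_self)) hσ) (Ideal.mem_sup_right hσ)

end HilbertFunction

section Socle

theorem le_colon_of_pow_add_le {R : Type*} [CommSemiring R] {I J : Ideal R} {i j : ℕ}
    (h : J ^ (i + j) ≤ I) : J ^ i ≤ I.colon (J ^ j : Ideal R) := fun _ ha =>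
  Submodule.mem_colon.mpr fun _ hb => h (pow_add J i j ▸ Ideal.mul_mem_mul ha hb)

theorem mem_Ann_iff_of_mem_colon_mS {f : P k n} {σ : S k n} (hσ : σ ∈ (Ann f).colon (mS k n)) :
    σ ∈ Ann f ↔ pairing σ f = 0 := by
  rw [mem_Ann_iff]
  refine ⟨fun h => by simpa using h 1, fun h τ => ?_⟩
  have hτ := mem_colon_Ann_iff.mp hσ _ (sub_C_constantCoeff_mem_mS τ)
  rwa [sub_mul, ← smul_eq_C_mul, ← toDual_apply, map_sub, map_smul, toDual_apply, toDual_apply, h,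
    smul_zero, sub_zero] at hτ

theorem exists_degree_eq_deg {f : P k n} (hf : f ≠ 0) : ∃ a, a.degree = deg f ∧ f a ≠ 0 := by
  obtain ⟨a, ha, h⟩ := Finset.exists_mem_eq_sup f.support (Finsupp.support_nonempty_iff.mpr hf)
    Finsupp.degree
  exact ⟨a, h.symm, Finsupp.mem_support_iff.mp ha⟩

theorem colon_Ann_mS_le {f : P k n} (hf : f ≠ 0) :
    (Ann f).colon (mS k n) ≤ mS k n ^ deg f ⊔ Ann f := by
  intro σ hσ
  obtain ⟨a, ha, hfa⟩ := exists_degree_eq_deg hf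
  set δ : S k n := (pairing σ f / f a) • monomial a 1
  have hδ : δ ∈ mS k n ^ deg f :=
    Submodule.smul_of_tower_mem _ _ (monomial_mem_mS_pow a 1 ha.ge)
  have hδ_colon : δ ∈ (Ann f).colon (mS k n) := by
    have := le_colon_of_pow_add_le (mS_pow_deg_add_one_le_Ann f) hδ
    rwa [pow_one] at this
  have hsub : σ - δ ∈ Ann f := by
    rw [mem_Ann_iff_of_mem_colon_mS (sub_mem hσ hδ_colon), ← toDual_apply, map_sub, map_smul,
      toDual_apply, toDual_apply, pairing_monomial, smul_eq_mul, div_mul_cancel₀ _ hfa, sub_self]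
  rw [← add_sub_cancel δ σ]
  exact Submodule.add_mem_sup hδ hsub

theorem isSocleDegree_Ann {f : P k n} (hf : f ≠ 0) : IsSocleDegree (Ann f) (deg f) := by
  have hnonzero : {i | mQuot (Ann f) ^ i ≠ ⊥} = Set.Iic (deg f) := by
    ext i
    obtain ⟨a, ha, hfa⟩ := exists_degree_eq_deg hf
    rw [Set.mem_ofPred_eq, ne_eq, mQuot_pow_eq_bot_iff, Set.mem_Iic, ← not_lt, not_iff_not]
    refine ⟨fun h => ha ▸ mS_pow_le_Ann_iff.mp h a hfa, fun h => ?_⟩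
    exact (Ideal.pow_le_pow_right h).trans (mS_pow_deg_add_one_le_Ann f)
  rw [IsSocleDegree, hnonzero]
  exact isGreatest_Iic

/-- The coefficients of the linear part of `σ ⌟ f`, as a function of `σ`. -/
noncomputable def linearPart (f : P k n) : S k n →ₗ[k] (Fin n → k) :=
  LinearMap.pi fun i => toDual k n f ∘ₗ LinearMap.mulLeft k (X i)

theorem linearPart_apply (f : P k n) (σ : S k n) (i : Fin n) :
    linearPart f σ i = pairing (X i * σ) f := by
  simp [linearPart]

theorem mem_colon_mS_of_linearPart_eq_zero {f : P k n} {σ : S k n}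
    (hσ : σ ∈ (Ann f).colon (mS k n ^ 2 : Ideal (S k n))) (h : linearPart f σ = 0) :
    σ ∈ (Ann f).colon (mS k n) := by
  have hX : ∀ i, X i * σ ∈ Ann f := fun i => by
    rw [mem_Ann_iff_of_mem_colon_mS, ← linearPart_apply, h, Pi.zero_apply]
    refine mem_colon_Ann_iff.mpr fun τ hτ => ?_
    rw [← mul_assoc]
    refine mem_colon_Ann_iff.mp hσ _ ?_
    rw [pow_two]
    exact Ideal.mul_mem_mul hτ (X_mem_mS i)
  rw [mS_eq_span_range_X, Ideal.colon_span, Submodule.mem_colon]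
  rintro _ ⟨i, rfl⟩
  rw [smul_eq_mul, mul_comm]
  exact hX i

theorem exists_mem_mS_pow_linearPart_eq {f : P k n} {d : ℕ} (hd : deg f = d + 1)
    (hH : hilbertFunction (Ann f) d = n) (v : Fin n → k) :
    ∃ ρ ∈ mS k n ^ d, linearPart f ρ = v := by
  have hf : f ≠ 0 := by rintro rfl; simp [deg] at hd
  let ev : ↥(mS k n ^ d) →ₗ[k] (Fin n → k) :=
    linearPart f ∘ₗ (mS k n ^ d).subtype.restrictScalars k
  have hker : LinearMap.ker ev ≤ LinearMap.ker (gradedMk (Ann f) d) := fun ρ hρ => by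
    have hcolon : (ρ : S k n) ∈ (Ann f).colon (mS k n ^ 2 : Ideal (S k n)) :=
      le_colon_of_pow_add_le (by simpa [hd] using mS_pow_deg_add_one_le_Ann f) ρ.2
    rw [LinearMap.mem_ker, gradedMk_eq_zero_iff, ← hd]
    exact colon_Ann_mS_le hf (mem_colon_mS_of_linearPart_eq_zero hcolon hρ)
  have hsurj := (surjective_and_ker_eq_of_ker_le (gradedMk_surjective (Ann f) d) hker
    ((Module.finrank_fin_fun k).trans hH.symm)).1
  obtain ⟨ρ, hρ⟩ := hsurj v
  exact ⟨ρ, ρ.2, hρ⟩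

theorem colon_Ann_mS_sq_le {f : P k n} {d : ℕ} (hd : deg f = d + 1)
    (hH : hilbertFunction (Ann f) d = n) :
    (Ann f).colon (mS k n ^ 2 : Ideal (S k n)) ≤ mS k n ^ d ⊔ Ann f := by
  intro σ hσ
  have hf : f ≠ 0 := by rintro rfl; simp [deg] at hd
  obtain ⟨ρ, hρ, hlinear⟩ := exists_mem_mS_pow_linearPart_eq hd hH (linearPart f σ)
  have hρ_colon : ρ ∈ (Ann f).colon (mS k n ^ 2 : Ideal (S k n)) :=
    le_colon_of_pow_add_le (by simpa [hd] using mS_pow_deg_add_one_le_Ann f) hρ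
  have hsub : σ - ρ ∈ mS k n ^ deg f ⊔ Ann f := colon_Ann_mS_le hf <|
    mem_colon_mS_of_linearPart_eq_zero (sub_mem hσ hρ_colon)
      (by rw [map_sub, hlinear, sub_self])
  have hpow : mS k n ^ deg f ⊔ Ann f ≤ mS k n ^ d ⊔ Ann f :=
    sup_le_sup_right (Ideal.pow_le_pow_right (by omega)) _
  rw [← add_sub_cancel ρ σ]
  exact add_mem (Ideal.mem_sup_left hρ) (hpow hsub)

end Socle

section Compressed

theorem lt_choose_of_two_le {n d : ℕ} (hn : 2 ≤ n) (hd : 2 ≤ d) : n < (d + n - 1).choose d := calc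
  n < n + n.choose 2 := Nat.lt_add_of_pos_right (Nat.choose_pos hn)
  _ = (n + 1).choose 2 := by rw [Nat.choose_succ_succ', Nat.choose_one_right]
  _ = (n + 1).choose (n - 1) := (Nat.choose_symm_of_eq_add (by omega)).symm
  _ ≤ (d + n - 1).choose (n - 1) := Nat.choose_le_choose _ (by omega)
  _ = (d + n - 1).choose d := Nat.choose_symm_of_eq_add (by omega)

namespace IsCompressed

variable {f : P k n} {t : ℕ}

theorem hilbertFunction_deg_sub_one (hf : IsCompressed (Ann f) t) (hf0 : f ≠ 0) :
    hilbertFunction (Ann f) (deg f - 1) = n := by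
  obtain ⟨-, -, d, hd, hHd⟩ := hf
  rwa [hd.unique (isSocleDegree_Ann hf0)] at hHd

theorem add_two_le_deg (hf : IsCompressed (Ann f) t) (hdeg : 3 ≤ deg f)
    (ht : n = 1 → t + 2 ≤ deg f) : t + 2 ≤ deg f := by
  have hf0 : f ≠ 0 := by rintro rfl; simp [deg] at hdeg
  by_contra hlt
  have hn0 : n ≠ 0 := by
    rintro rfl
    obtain ⟨a, ha, -⟩ := exists_degree_eq_deg hf0
    rw [Subsingleton.elim a 0, map_zero] at ha
    omega
  have hn1 : n ≠ 1 := fun hn => hlt (ht hn)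
  have hchoose := hf.2.1 (deg f - 1) (by omega)
  rw [hf.hilbertFunction_deg_sub_one hf0] at hchoose
  exact (lt_choose_of_two_le (by omega) (by omega)).ne hchoose

theorem colon_Ann_mS_sq_le (hf : IsCompressed (Ann f) t) (htd : t + 2 ≤ deg f) :
    (Ann f).colon (mS k n ^ 2 : Ideal (S k n)) ≤ mS k n ^ (t + 1) := by
  have hf0 : f ≠ 0 := by rintro rfl; simp [deg] at htd
  refine (Apolarity.colon_Ann_mS_sq_le (d := deg f - 1) (by omega)
    (hf.hilbertFunction_deg_sub_one hf0)).trans (sup_le (Ideal.pow_le_pow_right (by omega)) ?_)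
  exact le_mS_pow_of_hilbertFunction_eq fun i hi => hf.2.1 i (Nat.lt_succ_iff.mp hi)

end IsCompressed

theorem cast_factorial_ne_zero_of_lt_ringChar {d : ℕ} (h : ringChar k = 0 ∨ d < ringChar k) :
    (d.factorial : k) ≠ 0 := by
  rw [Ne, ringChar.spec]
  obtain h | h := h
  · rw [h, zero_dvd_iff]
    exact d.factorial_ne_zero
  · have hp : (ringChar k).Prime :=
      (CharP.char_is_prime_or_zero k (ringChar k)).resolve_right (by omega)
    rw [hp.dvd_factorial, not_le]
    exact h

theorem partGE_sub_self_mem_PLE (f : P k n) (e : ℕ) : partGE (e + 1) f - f ∈ PLE k n e := by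
  intro a ha
  rw [Set.mem_ofPred_eq]
  by_contra! hlt
  refine Finsupp.mem_support_iff.mp ha ?_
  rw [Finsupp.sub_apply, partGE, Finsupp.filter_apply_pos (fun a => e + 1 ≤ a.degree) f hlt,
    sub_self]

end Compressed

end Apolarity

theorem mainTheorem4_general {k : Type*} [Field k] {n : ℕ}
    (f : Apolarity.P k n) (t : ℕ)
    (hchar : ringChar k = 0 ∨ Apolarity.deg f < ringChar k)
    (hdeg : 3 ≤ Apolarity.deg f)
    (hf : Apolarity.IsCompressed (Apolarity.Ann f) t)
    (ht : n = 1 → t + 2 ≤ Apolarity.deg f) :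
    (∀ h ∈ Apolarity.PLE k n (t + 1), f + h ∈ Apolarity.orbitPlus f) ∧
      Apolarity.partGE (t + 2) f ∈ Apolarity.orbitPlus f ∧
      Nonempty (Apolarity.Apolar f ≃ₐ[k] Apolarity.Apolar (Apolarity.partGE (t + 2) f)) := by
  have htd := hf.add_two_le_deg hdeg ht
  have hadd : ∀ h ∈ Apolarity.PLE k n (t + 1), f + h ∈ Apolarity.orbitPlus f := fun h hh =>
    Apolarity.add_mem_orbitPlus (Apolarity.cast_factorial_ne_zero_of_lt_ringChar hchar)
      t.succ_ne_zero (by omega) le_rfl (Apolarity.mS_pow_deg_add_one_le_Ann f)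
      (hf.colon_Ann_mS_sq_le htd) (Apolarity.mS_pow_add_one_le_Ann_of_mem_PLE hh)
  have hpart : Apolarity.partGE (t + 2) f ∈ Apolarity.orbitPlus f := by
    simpa using hadd _ (Apolarity.partGE_sub_self_mem_PLE f (t + 1))
  exact ⟨hadd, hpart, Apolarity.apolar_algEquiv_of_mem_orbitPlus hpart⟩

theorem mainTheorem4 {k : Type*} [Field k] [IsAlgClosed k] {n : ℕ}
    (f : Apolarity.P k n) (t : ℕ)
    (hchar : ringChar k = 0 ∨ Apolarity.deg f < ringChar k)
    (hdeg : 3 ≤ Apolarity.deg f)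
    (hf : Apolarity.IsCompressed (Apolarity.Ann f) t)
    (ht : n = 1 → t + 2 ≤ Apolarity.deg f) :
    (∀ h ∈ Apolarity.PLE k n (t + 1), f + h ∈ Apolarity.orbitPlus f) ∧
      Apolarity.partGE (t + 2) f ∈ Apolarity.orbitPlus f ∧
      Nonempty (Apolarity.Apolar f ≃ₐ[k] Apolarity.Apolar (Apolarity.partGE (t + 2) f)) :=
  mainTheorem4_general f t hchar hdeg hf ht
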